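/- Let $k\ge 2$ and let $m_1,\dots,m_k,M_1,\dots,M_k$ be positive integers. Let $O_k=O_k(m_1,\dots,m_k,M_1,\dots,M_k)$ be the finite lattice whose elements are $t_0,t_1,\dots,t_k$, $z_{i,1},\dots,z_{i,m_i}$ and $z_{i+k,1},\dots,z_{i+k,M_i}$ ($1\le i\le k$), with the partial order generated by $$t_{i-1}<z_{i,1}<z_{i,2}<\cdots<z_{i,m_i}<t_i,\qquad t_{i-1}<z_{i+k,1}<z_{i+k,2}<\cdots<z_{i+k,M_i}<t_i\qquad(1\le i\le k).$$ Let $K$ be a field, let $K[O_k]$ be the polynomial ring over $K$ whose variables are the elements of $O_k$, and let $I_{O_k}\subset K[O_k]$ be the join-meet ideal, generated by all $ab-(a\vee b)(a\wedge b)$ with $a,b\in O_k$. Let $\prec$ be any compatible monomial order on $K[O_k]$, i.e. one for which the initial monomial of $ab-(a\vee b)(a\wedge b)$ is $ab$ whenever $a,b\in O_k$ are incomparable, and let $\mathrm{in}_\prec(I_{O_k})$ be the initial ideal, generated by the initial monomials of all nonzero elements of $I_{O_k}$. Then the projective dimension of the $K[O_k]$-module $K[O_k]/\mathrm{in}_\prec(I_{O_k})$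 satisfies $$\max\{m_1,\dots,m_k,M_1,\dots,M_k\}\ \le\ \operatorname{proj\,dim}\bigl(K[O_k]/\mathrm{in}_\prec(I_{O_k})\bigr)\ \le\ k+1+\sum_{i=1}^k(m_i+M_i).$$ -/

import Mathlib

/-- The join-meet ideal `I_L` of a lattice `L`: the ideal of the polynomial ring `K[L]`, whose
variables are the elements of `L`, generated by all `a b - (a ∨ b) (a ∧ b)` with `a, b ∈ L`. -/
noncomputable def joinMeetIdeal (K : Type*) [Field K] (L : Type*) [Lattice L] :
    Ideal (MvPolynomial L K) :=
  Ideal.span {f | ∃ a b : L, f =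
    MvPolynomial.X a * MvPolynomial.X b - MvPolynomial.X (a ⊔ b) * MvPolynomial.X (a ⊓ b)}

/-- The initial ideal `in_≺(I)`: the ideal generated by the initial monomials of all nonzero
elements of `I`. -/
noncomputable def initialIdeal {K : Type*} [Field K] {σ : Type*} (ord : MonomialOrder σ)
    (I : Ideal (MvPolynomial σ K)) : Ideal (MvPolynomial σ K) :=
  Ideal.span {u | ∃ f ∈ I, f ≠ 0 ∧ u = MvPolynomial.monomial (ord.degree f) 1}

/-- A monomial order on `K[L]` is compatible if, for all incomparable `a, b ∈ L`, the initial
monomial of `a b - (a ∨ b) (a ∧ b)` is `a b`. -/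
def IsCompatibleOrder (K : Type*) [Field K] (L : Type*) [Lattice L]
    (ord : MonomialOrder L) : Prop :=
  ∀ a b : L, ¬ a ≤ b → ¬ b ≤ a →
    ord.degree (MvPolynomial.X a * MvPolynomial.X b
        - MvPolynomial.X (a ⊔ b) * MvPolynomial.X (a ⊓ b) : MvPolynomial L K)
      = Finsupp.single a 1 + Finsupp.single b 1

/-- The underlying set of `O_k(m_1, …, m_k, M_1, …, M_k)`. Blocks are indexed by `i : Fin k`
(counted from `0`); block `i` lies between `t i.castSucc` and
`t i.succ`, and consists of the two chains `z i 0 < z i 1 < ⋯` (of length `m i`) and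
`w i 0 < w i 1 < ⋯` (of length `M i`). -/
inductive OLattice {k : ℕ} (m M : Fin k → ℕ) : Type
  | t (i : Fin (k + 1)) : OLattice m M
  | z (i : Fin k) (r : Fin (m i)) : OLattice m M
  | w (i : Fin k) (r : Fin (M i)) : OLattice m M

namespace OLattice

variable {k : ℕ} {m M : Fin k → ℕ}

/-- The order relation of `O_k`: the reflexive transitive relation generated by the chain
`t 0 < ⋯ < t k` and, for each block `i`, the chains
`t i.castSucc < z i 0 < z i 1 < ⋯ < t i.succ` and `t i.castSucc < w i 0 < w i 1 < ⋯ < t i.succ`. -/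
protected def le : OLattice m M → OLattice m M → Prop
  | t i, t j => i ≤ j
  | t i, z j _ => i ≤ j.castSucc
  | t i, w j _ => i ≤ j.castSucc
  | z i _, t j => i.succ ≤ j
  | w i _, t j => i.succ ≤ j
  | z i r, z j r' => i < j ∨ (i = j ∧ r.val ≤ r'.val)
  | w i r, w j r' => i < j ∨ (i = j ∧ r.val ≤ r'.val)
  | z i _, w j _ => i < j
  | w i _, z j _ => i < j

/-- The index of the smallest `t j` above an element. -/
protected def ceil : OLattice m M → Fin (k + 1)
  | t i => i
  | z i _ => i.succ
  | w i _ => i.succ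

/-- The index of the largest `t j` below an element. -/
protected def floor : OLattice m M → Fin (k + 1)
  | t i => i
  | z i _ => i.castSucc
  | w i _ => i.castSucc

instance : PartialOrder (OLattice m M) where
  le := OLattice.le
  le_refl a := by cases a <;> simp [OLattice.le]
  le_trans a b c hab hbc := by
    cases a <;> cases b <;> cases c <;>
      simp only [OLattice.le, Fin.le_def, Fin.lt_def, Fin.ext_iff, Fin.val_succ,
        Fin.val_castSucc] at * <;> omega
  le_antisymm a b hab hba := by
    rcases a with i | ⟨i, r⟩ | ⟨i, r⟩ <;> rcases b with j | ⟨j, r'⟩ | ⟨j, r'⟩ <;>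
      simp only [OLattice.le, Fin.le_def, Fin.lt_def, Fin.ext_iff, Fin.val_succ,
        Fin.val_castSucc] at hab hba
    all_goals try omega
    · exact congrArg t (Fin.ext (by omega))
    · obtain rfl : i = j := Fin.ext (by omega)
      exact congrArg (z i) (Fin.ext (by omega))
    · obtain rfl : i = j := Fin.ext (by omega)
      exact congrArg (w i) (Fin.ext (by omega))

theorem le_iff (a b : OLattice m M) : a ≤ b ↔ OLattice.le a b := Iff.rfl

open Classical in
/-- The lattice structure of `O_k`: two incomparable elements lie in the same block, and their
join and meet are the top and the bottom of that block. -/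
noncomputable instance : Lattice (OLattice m M) where
  sup a b := if a ≤ b then b else if b ≤ a then a else t a.ceil
  inf a b := if a ≤ b then a else if b ≤ a then b else t a.floor
  le_sup_left a b := by
    split_ifs with h₁ h₂
    · exact h₁
    · exact le_rfl
    · cases a <;> simp [le_iff, OLattice.le, OLattice.ceil]
  le_sup_right a b := by
    split_ifs with h₁ h₂
    · exact le_rfl
    · exact h₂
    · cases a <;> cases b <;>
        simp only [le_iff, OLattice.le, OLattice.ceil, Fin.le_def, Fin.lt_def, Fin.ext_iff,
          Fin.val_succ, Fin.val_castSucc] at * <;> omega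
  sup_le a b c hac hbc := by
    split_ifs with h₁ h₂
    · exact hbc
    · exact hac
    · cases a <;> cases b <;> cases c <;>
        simp only [le_iff, OLattice.le, OLattice.ceil, Fin.le_def, Fin.lt_def, Fin.ext_iff,
          Fin.val_succ, Fin.val_castSucc] at * <;> omega
  inf_le_left a b := by
    split_ifs with h₁ h₂
    · exact le_rfl
    · exact h₂
    · cases a <;> simp [le_iff, OLattice.le, OLattice.floor]
  inf_le_right a b := by
    split_ifs with h₁ h₂
    · exact h₁
    · exact le_rfl
    · cases a <;> cases b <;>
        simp only [le_iff, OLattice.le, OLattice.floor, Fin.le_def, Fin.lt_def, Fin.ext_iff,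
          Fin.val_succ, Fin.val_castSucc] at * <;> omega
  le_inf c a b hca hcb := by
    split_ifs with h₁ h₂
    · exact hca
    · exact hcb
    · cases a <;> cases b <;> cases c <;>
        simp only [le_iff, OLattice.le, OLattice.floor, Fin.le_def, Fin.lt_def, Fin.ext_iff,
          Fin.val_succ, Fin.val_castSucc] at * <;> omega

end OLattice

-- The upper bound is Hilbert's syzygy theorem (`MvPolynomial.projectiveDimension_le_card`): `O_k`
-- has `k + 1 + ∑ (m i + M i)` elements, one variable each.
--
-- For the lower bound, fix `w` in one chain of a block and let `Z` be the opposite chain.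
-- Compatibility puts every `w z` in the initial ideal `J`, and no monomial of `J` is a power of
-- `w`, since incomparable elements never join to `w`. Let `E = K[Z]`, with `w` acting as `1` and
-- the variables outside `Z ∪ {w}` as `0`. On `Ext(S/J, E)` each `z` acts as `w z`, hence as `0`,
-- while `Z` is `E`-regular. Dimension shifting embeds `Hom(S/J, E/(Z)E)`, which is nonzero, into
-- `Ext` in degree `#Z` (`ext_subsingleton_and_nontrivial`, `card_le_projectiveDimension`).

universe u

/-! ### Flat base change -/

theorem shortExact_baseChange {A B : Type u} [CommRing A] [CommRing B] [Algebra A B]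
    [Module.Flat A B] {M₁ M₂ M₃ : Type u} [AddCommGroup M₁] [AddCommGroup M₂] [AddCommGroup M₃]
    [Module A M₁] [Module A M₂] [Module A M₃] {i : M₁ →ₗ[A] M₂} {f : M₂ →ₗ[A] M₃}
    (hi : Function.Injective i) (hif : Function.Exact i f) (hf : Function.Surjective f) :
    (ModuleCat.shortComplexOfCompEqZero (i.baseChange B) (f.baseChange B) (by
      rw [← LinearMap.baseChange_comp, hif.linearMap_comp_eq_zero,
        LinearMap.baseChange_zero])).ShortExact where
  exact := ModuleCat.shortComplex_exact _ (Module.Flat.lTensor_exact B hif)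
  mono_f := (ModuleCat.mono_iff_injective _).2
    (Module.Flat.lTensor_preserves_injective_linearMap i hi)
  epi_g := (ModuleCat.epi_iff_surjective _).2 (LinearMap.lTensor_surjective B hf)

open CategoryTheory in
/-- Flat base change does not increase projective dimension. -/
theorem hasProjectiveDimensionLE_baseChange {A B : Type u} [CommRing A] [CommRing B] [Algebra A B]
    [Module.Flat A B] (n : ℕ) (M : Type u) [AddCommGroup M] [Module A M]
    (h : HasProjectiveDimensionLE (ModuleCat.of A M) n) :
    HasProjectiveDimensionLE (ModuleCat.of B (TensorProduct A B M)) n := by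
  induction n generalizing M with
  | zero =>
    simp only [HasProjectiveDimensionLE, zero_add,
      ← projective_iff_hasProjectiveDimensionLT_one, ← IsProjective.iff_projective] at h ⊢
    infer_instance
  | succ n ih =>
    -- Dimension shift along the free cover on all elements of `M`; flatness keeps its kernel
    -- sequence exact.
    let f : (M →₀ A) →ₗ[A] M := Finsupp.linearCombination A id
    have hf : Function.Surjective f := Finsupp.linearCombination_id_surjective A M
    have hS := LinearMap.shortExact_shortComplexKer hf
    have hK := ih (LinearMap.ker f)
      ((hS.hasProjectiveDimensionLT_X₃_iff n (by
        dsimp; rw [← IsProjective.iff_projective]; infer_instance)).1 h)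
    have hT := shortExact_baseChange (B := B) (Submodule.injective_subtype _)
      (LinearMap.exact_subtype_ker_map f) hf
    exact (hT.hasProjectiveDimensionLT_X₃_iff n (by
        dsimp; rw [← IsProjective.iff_projective]; infer_instance)).2 hK

/-! ### The sequence `0 → M[X] → M[X] → M → 0` of an `A[X]`-module -/

namespace PolynomialModule

open Polynomial

variable {A : Type u} [CommRing A] (M : Type u) [AddCommGroup M] [Module A M] [Module A[X] M]
  [IsScalarTower A A[X] M]

/-- The evaluation `∑ mᵢ Xⁱ ↦ ∑ Xⁱ • mᵢ` for an `A[X]`-module `M`. -/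
noncomputable def evalX : PolynomialModule A M →ₗ[A[X]] M where
  toFun q := q.coeff.sum fun i m => (X : A[X]) ^ i • m
  map_add' p q := by
    rw [coeff_add, Finsupp.sum_add_index'] <;> simp
  map_smul' p q := by
    have add : ∀ a b : PolynomialModule A M, (a + b).coeff.sum (fun i m => (X : A[X]) ^ i • m) =
        a.coeff.sum (fun i m => (X : A[X]) ^ i • m) +
          b.coeff.sum (fun i m => (X : A[X]) ^ i • m) := fun a b => by
      rw [coeff_add, Finsupp.sum_add_index'] <;> simp
    induction p using Polynomial.induction_on' with
    | add p p' h h' => rw [add_smul, add, h, h']; simp [add_smul]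
    | monomial i r =>
      induction q using PolynomialModule.induction_linear with
      | zero => simp
      | add a b ha hb => rw [smul_add, add, ha, hb, add]; simp
      | single j m =>
        rw [monomial_smul_single]
        simp only [coeff_single, smul_zero, Finsupp.sum_single_index, RingHom.id_apply]
        rw [← C_mul_X_pow_eq_monomial, ← algebraMap_smul A[X] r m, ← Polynomial.algebraMap_eq,
          smul_smul, smul_smul]
        congr 1; ring

theorem evalX_single (i : ℕ) (m : M) : evalX M (single A i m) = (X : A[X]) ^ i • m := by
  simp [evalX]

/-- Multiplication by `X` on an `A[X]`-module, as an `A`-linear map. -/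
noncomputable def mulX : M →ₗ[A] M where
  toFun m := (X : A[X]) • m
  map_add' := smul_add _
  map_smul' r m := by
    rw [← algebraMap_smul A[X] r m, RingHom.id_apply, ← algebraMap_smul A[X] r, smul_comm]

/-- The map `single i m ↦ single (i + 1) m - single i (X • m)`. -/
noncomputable def shiftSub : PolynomialModule A M →ₗ[A[X]] PolynomialModule A M where
  toFun q := (X : A[X]) • q - map A (mulX M) q
  map_add' p q := by rw [smul_add, map_add]; abel
  map_smul' p q := by
    rw [map_smul, smul_sub, smul_comm]; simp

theorem shiftSub_single (i : ℕ) (m : M) :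
    shiftSub M (single A i m) = single A (i + 1) m - single A i ((X : A[X]) • m) := by
  change (X : A[X]) • single A i m - map A (mulX M) (single A i m) = _
  rw [map_single, ← monomial_one_one_eq_X, monomial_smul_single, one_smul, add_comm,
    monomial_one_one_eq_X]
  rfl

/-- An element of the kernel satisfies `qᵢ = X qᵢ₊₁`, so `qᵢ = Xⁿ qᵢ₊ₙ`, which vanishes once `i + n`
passes the support. -/
theorem shiftSub_injective : Function.Injective (shiftSub (A := A) M) := by
  have key : ∀ (q : PolynomialModule A M) (i : ℕ),
      (shiftSub M q).coeff (i + 1) = q.coeff i - (X : A[X]) • q.coeff (i + 1) := by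
    intro q i
    induction q using PolynomialModule.induction_linear with
    | zero => simp
    | add a b ha hb => rw [(shiftSub M).map_add, coeff_add, coeff_add, Finsupp.add_apply, Finsupp.add_apply, Finsupp.add_apply,
        ha, hb, smul_add]; abel
    | single j m =>
      rw [shiftSub_single, sub_eq_add_neg, coeff_add]
      have : (-single A j ((X : A[X]) • m)).coeff = -(single A j ((X : A[X]) • m)).coeff := rfl
      rw [this]
      simp only [coeff_single, Finsupp.add_apply, Finsupp.neg_apply, Finsupp.single_apply]
      split_ifs <;> first | omega | simp [sub_eq_add_neg]
  rw [← LinearMap.ker_eq_bot, LinearMap.ker_eq_bot']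
  intro q hq
  have step : ∀ i, q.coeff i = (X : A[X]) • q.coeff (i + 1) := fun i => by
    have := key q i
    rw [hq] at this
    exact (sub_eq_zero.1 (by simpa using this.symm))
  have iter : ∀ n i, q.coeff i = (X : A[X]) ^ n • q.coeff (i + n) := by
    intro n
    induction n with
    | zero => simp
    | succ n ih => intro i; rw [ih i, step (i + n), smul_smul, pow_succ]; rfl
  rw [← coeff_eq_zero]
  ext i
  rw [iter (q.coeff.support.sup id + 1) i]
  have : q.coeff (i + (q.coeff.support.sup id + 1)) = 0 := by
    by_contra h
    have := Finset.le_sup (f := id) (Finsupp.mem_support_iff.2 h)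
    simp only [id] at this
    omega
  rw [this]; simp

/-- Modulo the range, `single (j + 1) m` equals `single j (X • m)`, so every `q` reduces to its
evaluation placed in degree `0`. -/
theorem exact_shiftSub_evalX : Function.Exact (shiftSub (A := A) M) (evalX M) := by
  rw [LinearMap.exact_iff]
  have red : ∀ q : PolynomialModule A M, q - single A 0 (evalX M q) ∈ (shiftSub (A := A) M).range := by
    intro q
    induction q using PolynomialModule.induction_linear with
    | zero => simp
    | add a b ha hb =>
      have := add_mem ha hb
      rw [map_add, single_add]
      convert this using 1
      abel
    | single j m =>
      rw [evalX_single]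
      induction j generalizing m with
      | zero => simp
      | succ j ih =>
        have h1 : shiftSub (A := A) M (single A j m) ∈ (shiftSub (A := A) M).range := ⟨_, rfl⟩
        have := add_mem h1 (ih ((X : A[X]) • m))
        rw [shiftSub_single, smul_smul, ← pow_succ] at this
        convert this using 1
        abel
  apply le_antisymm
  · intro q hq
    have := red q
    rw [LinearMap.mem_ker.1 hq] at this
    simpa using this
  · rintro _ ⟨q, rfl⟩
    rw [LinearMap.mem_ker]
    induction q using PolynomialModule.induction_linear with
    | zero => simp
    | add a b ha hb => rw [map_add, map_add, ha, hb, add_zero]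
    | single j m =>
      rw [shiftSub_single, map_sub, evalX_single, evalX_single, smul_smul, ← pow_succ, sub_self]

theorem evalX_surjective : Function.Surjective (evalX (A := A) M) := fun m =>
  ⟨single A 0 m, by simp [evalX_single]⟩

end PolynomialModule

/-! ### Hilbert's syzygy theorem -/

open CategoryTheory Polynomial in
/-- If all `A`-modules have projective dimension at most `n`, then all `A[X]`-modules have
projective dimension at most `n + 1`. -/
theorem hasProjectiveDimensionLE_polynomial {A : Type u} [CommRing A] (n : ℕ)
    (h : ∀ M : ModuleCat.{u} A, HasProjectiveDimensionLE M n) (M : ModuleCat.{u} A[X]) :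
    HasProjectiveDimensionLE M (n + 1) := by
  let : Module A M := Module.compHom M (algebraMap A A[X])
  have : IsScalarTower A A[X] M := IsScalarTower.of_algebraMap_smul fun _ _ => rfl
  have hP : HasProjectiveDimensionLE (ModuleCat.of A[X] (PolynomialModule A M)) n := by
    have := hasProjectiveDimensionLE_baseChange (B := A[X]) n M (h _)
    exact hasProjectiveDimensionLT_of_iso
      (PolynomialModule.polynomialTensorProductLEquivPolynomialModule (R := A) (M := M)).toModuleIso _
  let T := ModuleCat.shortComplexOfCompEqZero (PolynomialModule.shiftSub (A := A) M)
    (PolynomialModule.evalX M) (PolynomialModule.exact_shiftSub_evalX M).linearMap_comp_eq_zero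
  have hT : T.ShortExact :=
    { exact := ModuleCat.shortComplex_exact _ (PolynomialModule.exact_shiftSub_evalX M)
      mono_f := (ModuleCat.mono_iff_injective _).2 (PolynomialModule.shiftSub_injective M)
      epi_g := (ModuleCat.epi_iff_surjective _).2 (PolynomialModule.evalX_surjective M) }
  exact hT.hasProjectiveDimensionLT_X₃ (n + 1) hP (hasProjectiveDimensionLT_of_ge _ (n + 1) _ (by omega))

open CategoryTheory in
theorem hasProjectiveDimensionLE_of_ringEquiv {R R' : Type u} [CommRing R] [CommRing R']
    (e : R ≃+* R') (n : ℕ) (h : ∀ M : ModuleCat.{u} R, HasProjectiveDimensionLE M n)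
    (N : ModuleCat.{u} R') : HasProjectiveDimensionLE N n := by
  let : Module R N := Module.compHom N (e : R →+* R')
  let := RingHomInvPair.of_ringEquiv e
  let := RingHomInvPair.of_ringEquiv e.symm
  have := h (ModuleCat.of R N)
  let e' : ModuleCat.of R N ≃ₛₗ[RingHomClass.toRingHom e] N :=
    { AddEquiv.refl N with map_smul' := fun _ _ => rfl }
  exact ModuleCat.hasProjectiveDimensionLE_of_semiLinearEquiv e e' n

open CategoryTheory in
theorem MvPolynomial.hasProjectiveDimensionLE_fin (K : Type u) [Field K] (n : ℕ)
    (M : ModuleCat.{u} (MvPolynomial (Fin n) K)) : HasProjectiveDimensionLE M n := by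
  induction n with
  | zero =>
    refine hasProjectiveDimensionLE_of_ringEquiv
      (MvPolynomial.isEmptyRingEquiv K (Fin 0)).symm 0 (fun N => ?_) M
    -- Without variables the ring is the field `K`, over which every module is projective.
    simp only [HasProjectiveDimensionLE, zero_add,
      ← projective_iff_hasProjectiveDimensionLT_one]
    infer_instance
  | succ n ih =>
    exact hasProjectiveDimensionLE_of_ringEquiv (MvPolynomial.finSuccEquiv K n).symm.toRingEquiv
      (n + 1) (hasProjectiveDimensionLE_polynomial n ih) M

open CategoryTheory in
/-- **Hilbert's syzygy theorem**, as a bound on projective dimension. -/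
theorem MvPolynomial.projectiveDimension_le_card (K : Type u) [Field K] {σ : Type} [Fintype σ]
    (M : ModuleCat.{u} (MvPolynomial σ K)) :
    projectiveDimension M ≤ (Fintype.card σ : WithBot ℕ∞) := by
  rw [projectiveDimension_le_iff]
  exact hasProjectiveDimensionLE_of_ringEquiv
    (MvPolynomial.renameEquiv K (Fintype.equivFin σ)).symm.toRingEquiv _
    (MvPolynomial.hasProjectiveDimensionLE_fin K _) M

/-! ### Nonvanishing of `Ext` along a regular sequence -/

-- A class killed by `S.f` comes from `Ext N S.X₃` one degree lower through the connecting map; in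
-- degree `0` it is zero because `S.f` is mono.
open CategoryTheory Abelian in
theorem ext_X₁_subsingleton {C : Type*} [Category* C] [Abelian C] [HasExt.{u} C]
    {S : ShortComplex C} (hS : S.ShortExact) (N : C) {n : ℕ}
    (kill : ∀ (i : ℕ) (x : Ext N S.X₁ i), x.comp (Ext.mk₀ S.f) (add_zero i) = 0)
    (van : ∀ i < n, Subsingleton (Ext N S.X₃ i)) :
    ∀ i < n + 1, Subsingleton (Ext N S.X₁ i) := by
  intro i hi
  refine subsingleton_of_forall_eq 0 fun x => ?_
  match i with
  | 0 =>
    obtain ⟨f, rfl⟩ := (Ext.mk₀_bijective N S.X₁).2 x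
    have := kill 0 (Ext.mk₀ f)
    rw [Ext.mk₀_comp_mk₀] at this
    have h0 := (Ext.mk₀_bijective _ _).1 (this.trans (Ext.mk₀_zero _ _).symm)
    have := hS.mono_f
    rw [Limits.zero_of_comp_mono S.f h0, Ext.mk₀_zero]
  | i + 1 =>
    obtain ⟨y, rfl⟩ := Ext.covariant_sequence_exact₁ N hS x (kill _ x) rfl
    have := van i (by omega)
    rw [Subsingleton.elim y 0, Ext.zero_comp]

-- Vanishing of the middle term makes the connecting map injective.
open CategoryTheory Abelian in
theorem ext_X₁_nontrivial {C : Type*} [Category* C] [Abelian C] [HasExt.{u} C]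
    {S : ShortComplex C} (hS : S.ShortExact) (N : C) {n : ℕ}
    (h₂ : Subsingleton (Ext N S.X₂ n)) (h₃ : Nontrivial (Ext N S.X₃ n)) :
    Nontrivial (Ext N S.X₁ (n + 1)) := by
  obtain ⟨y, hy⟩ := exists_ne (0 : Ext N S.X₃ n)
  refine nontrivial_of_ne (y.comp hS.extClass rfl) 0 fun h0 => hy ?_
  obtain ⟨x, hx⟩ := Ext.covariant_sequence_exact₃ N hS y rfl h0
  rw [← hx, Subsingleton.elim x 0, Ext.zero_comp]

open CategoryTheory Abelian RingTheory.Sequence in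
/-- Let `w` act as the identity on `E` and let `w r` annihilate `N` for every member `r` of an
`E`-regular sequence. Then `Ext N E` vanishes below the length of the sequence, and in that degree
it is nonzero as soon as there is a nonzero map from `N` to the quotient of `E`. -/
theorem ext_subsingleton_and_nontrivial {R : Type u} [CommRing R] (N : ModuleCat.{u} R) (w : R)
    (rs : List R) (E : ModuleCat.{u} R) (hw : ∀ x : E, w • x = x)
    (hN : ∀ r ∈ rs, ∀ x : N, (w * r) • x = 0) (reg : IsWeaklyRegular E rs) :
    (∀ i < rs.length, Subsingleton (Ext N E i)) ∧
      (Nontrivial (N →ₗ[R] E ⧸ (Ideal.ofList rs • ⊤ : Submodule R E)) →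
        Nontrivial (Ext N E rs.length)) := by
  induction rs generalizing E with
  | nil =>
    refine ⟨by simp, fun h => ?_⟩
    let e : (E ⧸ (Ideal.ofList ([] : List R) • ⊤ : Submodule R E)) ≃ₗ[R] E :=
      Submodule.quotEquivOfEqBot _ (by simp)
    have : Nontrivial (N →ₗ[R] E) := (LinearEquiv.congrRight e).toEquiv.nontrivial_congr.1 h
    have : Nontrivial (N ⟶ E) := (ModuleCat.homEquiv (M := N) (N := E)).nontrivial_congr.2 this
    exact (Ext.homEquiv₀ (X := N) (Y := E)).nontrivial_congr.2 this
  | cons r rs ih =>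
    rw [isWeaklyRegular_cons_iff] at reg
    obtain ⟨ih₁, ih₂⟩ := ih (ModuleCat.of R (QuotSMulTop r E))
      (fun x => by
        obtain ⟨y, rfl⟩ := Submodule.mkQ_surjective _ x
        rw [← map_smul, hw])
      (fun s hs => hN s (List.mem_cons_of_mem _ hs)) reg.2
    have hS : (E.smulShortComplex r).ShortExact := reg.1.smulShortComplex_shortExact
    have wid : w • 𝟙 E = 𝟙 E := by ext x; exact hw x
    -- As `w` is the identity on `E`, `r x = (w r) x`; moving the scalar to `N` makes it zero.
    have kill : ∀ (i : ℕ) (x : Ext N E i),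
        x.comp (Ext.mk₀ (E.smulShortComplex r).f) (add_zero i) = 0 := by
      intro i x
      have h2 : x = (w • Ext.mk₀ (𝟙 N)).comp x (zero_add i) := by
        rw [Ext.smul_comp, Ext.mk₀_id_comp, Ext.smul_eq_comp_mk₀, wid, Ext.comp_mk₀_id]
      have h3 : ((w * r) • 𝟙 N) = 0 := by
        ext x; exact hN r List.mem_cons_self x
      have h4 : x.comp (Ext.mk₀ (r • 𝟙 E)) (add_zero i) = 0 := by
        rw [← Ext.smul_eq_comp_mk₀, h2, ← Ext.smul_comp, smul_smul, ← Ext.mk₀_smul, mul_comm, h3,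
          Ext.mk₀_zero, Ext.zero_comp]
      exact h4
    have van := ext_X₁_subsingleton hS N kill ih₁
    have e := Submodule.quotOfListConsSMulTopEquivQuotSMulTopInner E r rs
    -- The first two terms of the sequence are both `E`, so `van` also supplies the vanishing of the
    -- middle one.
    exact ⟨van, fun h => ext_X₁_nontrivial hS N (van rs.length (by omega))
      (ih₂ ((LinearEquiv.congrRight e).toEquiv.nontrivial_congr.1 h))⟩

-- Membership in an ideal of variables is tested monomial by monomial, and a factor of a different
-- variable does not affect it.
open RingTheory.Sequence in
theorem MvPolynomial.isWeaklyRegular_map_X {τ K : Type*} [Field K] (l : List τ) (hl : l.Nodup) :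
    IsWeaklyRegular (MvPolynomial τ K) (l.map (X : τ → MvPolynomial τ K)) := by
  refine ⟨fun i hi => ?_⟩
  have hs : Ideal.ofList ((l.map (X : τ → MvPolynomial τ K)).take i) =
      Ideal.span (X '' {t | t ∈ l.take i}) := by
    rw [Ideal.ofList, ← List.map_take]
    congr 1
    ext p
    rw [Set.mem_ofPred_eq, List.mem_map]
    rfl
  have hi' : i < l.length := by simpa using hi
  rw [smul_eq_mul, Ideal.mul_top, hs, isSMulRegular_quotient_iff_mem_of_smul_mem]
  intro p hp
  rw [List.getElem_map, smul_eq_mul, mem_ideal_span_X_image, support_X_mul] at hp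
  rw [mem_ideal_span_X_image]
  intro d hd
  obtain ⟨t, ht, h⟩ := hp _ (Finset.mem_map_of_mem _ hd)
  refine ⟨t, ht, ?_⟩
  have hne : l[i] ≠ t := by
    rintro rfl
    obtain ⟨j, hj, hjl⟩ := List.mem_take_iff_getElem.1 ht
    have := (List.Nodup.getElem_inj_iff hl).1 hjl
    omega
  simpa [Finsupp.single_apply, hne] using h

open CategoryTheory Abelian RingTheory.Sequence MvPolynomial in
/-- If `J` is contained in the ideal of all variables other than `w` and `w z ∈ J` for all `z ∈ Z`,
then the quotient by `J` has projective dimension at least `#Z`. -/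
theorem card_le_projectiveDimension {σ : Type} {K : Type u} [Field K]
    (J : Ideal (MvPolynomial σ K)) (w : σ) (Z : Finset σ) (hwZ : w ∉ Z)
    (hJ : J ≤ Ideal.span (X '' {s | s ≠ w})) (hZ : ∀ z ∈ Z, X w * X z ∈ J) :
    (Z.card : WithBot ℕ∞) ≤ projectiveDimension (ModuleCat.of (MvPolynomial σ K)
      (MvPolynomial σ K ⧸ J)) := by
  classical
  let φ : MvPolynomial σ K →ₐ[K] MvPolynomial Z K :=
    aeval fun s => if h : s ∈ Z then X ⟨s, h⟩ else if s = w then 1 else 0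
  have φz : ∀ z : Z, φ (X z.1) = X z := fun z => by simp [φ]
  have φw : φ (X w) = 1 := by simp [φ, hwZ]
  let : Algebra (MvPolynomial σ K) (MvPolynomial Z K) := φ.toRingHom.toAlgebra
  have hmap : ∀ p, algebraMap (MvPolynomial σ K) (MvPolynomial Z K) p = φ p := fun _ => rfl
  let l : List Z := Finset.univ.toList
  let rs : List (MvPolynomial σ K) := l.map fun z => X z.1
  have hrs : rs.map (algebraMap (MvPolynomial σ K) (MvPolynomial Z K)) = l.map X := by
    simp only [rs, List.map_map]
    exact List.map_congr_left fun z _ => φz z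
  have hlen : rs.length = Z.card := by simp [rs, l]
  have reg : IsWeaklyRegular (MvPolynomial Z K) rs := by
    rw [← isWeaklyRegular_map_algebraMap_iff (S := MvPolynomial Z K), hrs]
    exact isWeaklyRegular_map_X l (Finset.nodup_toList _)
  -- The ideal of polynomials without constant term, used to see that `1` is nonzero in `E/(Z)E`.
  let I : Ideal (MvPolynomial Z K) := Ideal.span (X '' Set.univ)
  have hI : ∀ x ∈ (Ideal.ofList rs • ⊤ : Submodule (MvPolynomial σ K) (MvPolynomial Z K)), x ∈ I := by
    intro x hx
    induction hx using Submodule.smul_induction_on' with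
    | smul r hr n hn =>
      rw [Algebra.smul_def]
      refine I.mul_mem_right _ ?_
      rw [← Ideal.mem_comap]
      refine (Ideal.span_le.2 ?_ : Ideal.ofList rs ≤ _) hr
      intro p hp
      obtain ⟨z, -, rfl⟩ := List.mem_map.1 hp
      rw [SetLike.mem_coe, Ideal.mem_comap, hmap, φz]
      exact Ideal.subset_span ⟨z, trivial, rfl⟩
    | add x hx y hy h1 h2 => exact I.add_mem h1 h2
  -- Only `w` acts as a unit and it is missing from the generators bounding `J`; hence `1 ↦ 1`
  -- descends to `S/J`.
  have hJ' : ∀ f ∈ J, f • (1 : MvPolynomial Z K) ∈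
      (Ideal.ofList rs • ⊤ : Submodule (MvPolynomial σ K) (MvPolynomial Z K)) := by
    intro f hf
    replace hf := hJ hf
    induction hf using Submodule.span_induction with
    | mem x hx =>
      obtain ⟨s, hs, rfl⟩ := hx
      by_cases h : s ∈ Z
      · exact Submodule.smul_mem_smul (Ideal.subset_span
          (List.mem_map.2 ⟨⟨s, h⟩, by simp [l], rfl⟩)) trivial
      · have : φ (X s) = 0 := by simp [φ, h, show s ≠ w from hs]
        rw [Algebra.smul_def, hmap, this, zero_mul]
        exact zero_mem _
    | zero => simp
    | add x y _ _ hx hy => rw [add_smul]; exact add_mem hx hy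
    | smul a x _ hx => rw [smul_assoc]; exact Submodule.smul_mem _ _ hx
  let Q := MvPolynomial Z K ⧸ (Ideal.ofList rs • ⊤ : Submodule (MvPolynomial σ K) (MvPolynomial Z K))
  let g : (MvPolynomial σ K ⧸ J) →ₗ[MvPolynomial σ K] Q :=
    Submodule.liftQ J (LinearMap.toSpanSingleton _ Q (Submodule.Quotient.mk 1)) (by
      intro f hf
      rw [LinearMap.mem_ker, LinearMap.toSpanSingleton_apply, ← Submodule.Quotient.mk_smul,
        Submodule.Quotient.mk_eq_zero]
      exact hJ' f hf)
  have hg : g ≠ 0 := by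
    intro h
    have h1 : g (Submodule.Quotient.mk 1) = 0 := by rw [h]; rfl
    rw [Submodule.liftQ_apply, LinearMap.toSpanSingleton_apply, one_smul,
      Submodule.Quotient.mk_eq_zero] at h1
    have h2 := hI _ h1
    rw [mem_ideal_span_X_image] at h2
    obtain ⟨i, -, hi⟩ := h2 0 (by simp)
    exact hi rfl
  obtain ⟨-, nt⟩ := ext_subsingleton_and_nontrivial
    (ModuleCat.of (MvPolynomial σ K) (MvPolynomial σ K ⧸ J)) (X w) rs
    (ModuleCat.of (MvPolynomial σ K) (MvPolynomial Z K))
    (fun x => by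
      change (X w : MvPolynomial σ K) • (show MvPolynomial Z K from x) = x
      rw [Algebra.smul_def, hmap, φw, one_mul])
    (fun r hr x => by
      obtain ⟨z, -, rfl⟩ := List.mem_map.1 hr
      obtain ⟨y, rfl⟩ := Ideal.Quotient.mk_surjective x
      change Submodule.Quotient.mk _ = _
      exact (Submodule.Quotient.mk_eq_zero _).2 (J.mul_mem_right y (hZ z.1 z.2))) reg
  have nt' := nt (nontrivial_of_ne g 0 hg)
  rw [hlen] at nt'
  rw [projectiveDimension_ge_iff]
  intro hlt
  exact not_subsingleton_iff_nontrivial.2 nt' (HasProjectiveDimensionLT.subsingleton _ Z.card _ le_rfl _)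

/-! ### Initial ideals and ideals of variables -/

open MvPolynomial in
theorem X_mul_X_mem_initialIdeal {K : Type*} [Field K] {L : Type*} [Lattice L]
    {ord : MonomialOrder L} (hord : IsCompatibleOrder K L ord) {a b : L} (hab : ¬ a ≤ b)
    (hba : ¬ b ≤ a) : (X a * X b : MvPolynomial L K) ∈ initialIdeal ord (joinMeetIdeal K L) := by
  have hdeg := hord a b hab hba
  refine Ideal.subset_span ⟨_, Ideal.subset_span ⟨a, b, rfl⟩, fun h0 => ?_, ?_⟩
  -- The zero polynomial has degree `0`, so compatibility itself excludes it.
  · rw [h0, MonomialOrder.degree_zero] at hdeg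
    have := congrArg (fun d => d a) hdeg
    rw [Finsupp.add_apply, Finsupp.single_eq_same, Finsupp.zero_apply] at this
    omega
  · rw [hdeg, X, X, monomial_mul, one_mul]

-- An ideal of variables is monomial, so it contains the leading monomial of each of its nonzero
-- elements.
open MvPolynomial in
theorem initialIdeal_le_span_X {K : Type*} [Field K] {σ : Type*} (ord : MonomialOrder σ)
    {I : Ideal (MvPolynomial σ K)} {s : Set σ} (hI : I ≤ Ideal.span (X '' s)) :
    initialIdeal ord I ≤ Ideal.span (X '' s) := by
  refine Ideal.span_le.2 ?_
  rintro _ ⟨f, hf, hf0, rfl⟩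
  rw [SetLike.mem_coe, mem_ideal_span_X_image]
  intro d hd
  rw [Finset.mem_singleton.1 (support_monomial_subset hd)]
  exact mem_ideal_span_X_image.1 (hI hf) _ (ord.degree_mem_support hf0)

open MvPolynomial in
/-- If `w` is neither a join nor a meet of incomparable elements, then the join-meet ideal is
contained in the ideal of all variables other than `w`. -/
theorem joinMeetIdeal_le_span_X {K : Type*} [Field K] {L : Type*} [Lattice L] {w : L}
    (hw : ∀ a b : L, ¬ a ≤ b → ¬ b ≤ a → a ⊔ b ≠ w ∨ a ⊓ b ≠ w) :
    joinMeetIdeal K L ≤ Ideal.span (X '' {s | s ≠ w}) := by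
  have left : ∀ a b : L, a ≠ w → (X a * X b : MvPolynomial L K) ∈
      Ideal.span (X '' {s | s ≠ w}) := fun a b h =>
    Ideal.mul_mem_right _ _ (Ideal.subset_span ⟨a, h, rfl⟩)
  have either : ∀ a b : L, a ≠ w ∨ b ≠ w → (X a * X b : MvPolynomial L K) ∈
      Ideal.span (X '' {s | s ≠ w}) := fun a b h =>
    h.elim (left a b) fun h => mul_comm (X a : MvPolynomial L K) (X b) ▸ left b a h
  refine Ideal.span_le.2 ?_
  rintro _ ⟨a, b, rfl⟩
  by_cases hab : a ≤ b
  · rw [sup_eq_right.2 hab, inf_eq_left.2 hab, mul_comm, sub_self]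
    exact zero_mem _
  by_cases hba : b ≤ a
  · rw [sup_eq_left.2 hba, inf_eq_right.2 hba, sub_self]
    exact zero_mem _
  -- Incomparable `a`, `b` cannot both equal `w`, so each of the two products has a factor other
  -- than `X w`.
  refine sub_mem (either a b ?_) (either _ _ (hw a b hab hba))
  by_contra! h
  exact hab (h.1.trans h.2.symm).le

/-! ### Incomparable elements and cardinality of `O_k` -/

namespace OLattice

variable {k : ℕ} {m M : Fin k → ℕ}

theorem sup_eq_t {a b : OLattice m M} (hab : ¬ a ≤ b) (hba : ¬ b ≤ a) : a ⊔ b = t a.ceil := by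
  classical exact (if_neg hab).trans (if_neg hba)

theorem not_z_le_w (i : Fin k) (r : Fin (m i)) (s : Fin (M i)) :
    ¬ (z i r : OLattice m M) ≤ w i s := by
  simp [le_iff, OLattice.le]

theorem not_w_le_z (i : Fin k) (r : Fin (m i)) (s : Fin (M i)) :
    ¬ (w i s : OLattice m M) ≤ z i r := by
  simp [le_iff, OLattice.le]

/-- `O_k` is the disjoint union of the `t j`, the `z i r` and the `w i r`. -/
def equivSum (m M : Fin k → ℕ) :
    OLattice m M ≃ Fin (k + 1) ⊕ (Σ i, Fin (m i)) ⊕ (Σ i, Fin (M i)) where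
  toFun
    | t j => .inl j
    | z i r => .inr (.inl ⟨i, r⟩)
    | w i r => .inr (.inr ⟨i, r⟩)
  invFun
    | .inl j => t j
    | .inr (.inl x) => z x.1 x.2
    | .inr (.inr x) => w x.1 x.2
  left_inv x := by cases x <;> rfl
  right_inv x := by rcases x with _ | _ | _ <;> rfl

noncomputable instance : Fintype (OLattice m M) := Fintype.ofEquiv _ (equivSum m M).symm

theorem card_eq (m M : Fin k → ℕ) :
    Fintype.card (OLattice m M) = k + 1 + ∑ i, (m i + M i) := by
  rw [Fintype.card_congr (equivSum m M)]
  simp [Finset.sum_add_distrib]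

end OLattice

open CategoryTheory OLattice in
/-- An element `w`, distinct from all the `t j` and incomparable to all elements of a finite set
`Z`, bounds the projective dimension from below by the size of `Z`. -/
theorem OLattice.card_le_projectiveDimension {K : Type u} [Field K] {k : ℕ} {m M : Fin k → ℕ}
    {ord : MonomialOrder (OLattice m M)} (hord : IsCompatibleOrder K (OLattice m M) ord)
    (w : OLattice m M) (hw : ∀ j, t j ≠ w) (Z : Finset (OLattice m M))
    (hZ : ∀ z ∈ Z, ¬ w ≤ z ∧ ¬ z ≤ w) :
    (Z.card : WithBot ℕ∞) ≤ projectiveDimension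
      (ModuleCat.of (MvPolynomial (OLattice m M) K) (MvPolynomial (OLattice m M) K ⧸
        initialIdeal ord (joinMeetIdeal K (OLattice m M)))) :=
  _root_.card_le_projectiveDimension _ w Z (fun h => (hZ w h).1 le_rfl)
    (initialIdeal_le_span_X ord (joinMeetIdeal_le_span_X fun _ _ hab hba =>
      Or.inl (sup_eq_t hab hba ▸ hw _)))
    fun z hz => X_mul_X_mem_initialIdeal hord (hZ z hz).1 (hZ z hz).2

/-! ### The two bounds -/

theorem theorem2 (K : Type*) [Field K] (k : ℕ) (hk : 1 < k) (m M : Fin k → ℕ)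
    (hm : ∀ i, 1 ≤ m i) (hM : ∀ i, 1 ≤ M i)
    (ord : MonomialOrder (OLattice m M)) (hord : IsCompatibleOrder K (OLattice m M) ord) :
    ((max (Finset.univ.sup m) (Finset.univ.sup M) : ℕ) : WithBot ℕ∞) ≤
      CategoryTheory.projectiveDimension
        (ModuleCat.of (MvPolynomial (OLattice m M) K)
          (MvPolynomial (OLattice m M) K ⧸
            initialIdeal ord (joinMeetIdeal K (OLattice m M)))) ∧
    CategoryTheory.projectiveDimension
        (ModuleCat.of (MvPolynomial (OLattice m M) K)
          (MvPolynomial (OLattice m M) K ⧸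
            initialIdeal ord (joinMeetIdeal K (OLattice m M)))) ≤
      ((k + 1 + ∑ i, (m i + M i) : ℕ) : WithBot ℕ∞) := by
  constructor
  · have hne : (Finset.univ : Finset (Fin k)).Nonempty := ⟨⟨0, by omega⟩, Finset.mem_univ _⟩
    rcases max_choice (Finset.univ.sup m) (Finset.univ.sup M) with h | h <;> rw [h]
    · obtain ⟨i, -, hi⟩ := Finset.exists_mem_eq_sup _ hne m
      let f : Fin (m i) ↪ OLattice m M := ⟨OLattice.z i, fun _ _ h => by simpa using h⟩
      -- In the block with the longest `z`-chain, any element of the nonempty `w`-chain is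
      -- incomparable to all of that chain.
      have := OLattice.card_le_projectiveDimension hord (OLattice.w i ⟨0, hM i⟩) (by simp)
        (Finset.univ.map f) (by
          simp only [Finset.mem_map, Finset.mem_univ, true_and, forall_exists_index,
            forall_apply_eq_imp_iff]
          exact fun r => ⟨OLattice.not_w_le_z i r _, OLattice.not_z_le_w i r _⟩)
      rw [hi]
      simpa using this
    · obtain ⟨i, -, hi⟩ := Finset.exists_mem_eq_sup _ hne M
      let f : Fin (M i) ↪ OLattice m M := ⟨OLattice.w i, fun _ _ h => by simpa using h⟩
      have := OLattice.card_le_projectiveDimension hord (OLattice.z i ⟨0, hm i⟩) (by simp)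
        (Finset.univ.map f) (by
          simp only [Finset.mem_map, Finset.mem_univ, true_and, forall_exists_index,
            forall_apply_eq_imp_iff]
          exact fun r => ⟨OLattice.not_z_le_w i _ r, OLattice.not_w_le_z i _ r⟩)
      rw [hi]
      simpa using this
  · rw [← OLattice.card_eq]
    exact MvPolynomial.projectiveDimension_le_card K _
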